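/- Consider posets $(P,\le_P)$ with $P\subseteq\omega$, coded as subsets of $\omega$ by $P\oplus{\le_P}=\{2x : x\in P\}\cup\{2\langle x,y\rangle+1 : x\le_P y\}$, where $\langle\cdot,\cdot\rangle$ is a computable pairing function. In an infinite poset $(P,\le_P)$ an element $x$ is *small* if $x\le_P y$ for all but finitely many $y\in P$, *large* if $y\le_P x$ for all but finitely many $y\in P$, and *isolated* if $x$ is $\le_P$-incomparable with all but finitely many $y\in P$. The poset is *stable* if all its elements are small or isolated, or all its elements are large or isolated. It is *$\omega$-ordered* if $x\le_P y$ implies $x\le y$ for all $x,y\in P$. Let $\mathsf{SCAC}$ be the problem whose instances are the infinite stable posets $(P,\le_P)$ with $P\subseteq\omega$ and whose solutions to $(P,\le_P)$ are the infinite sets $Y\subseteq P$ that are chains or antichains in $(P,\le_P)$. Let $\omega\text{-}\mathsf{SCAC}$ be its restriction to $\omega$-ordered instances. A problem $\mathsf P$ is *strongly Weihrauch reducible* to a problem $\mathsf Q$, written $\mathsf P\le_{\mathrm{sW}}\mathsf Q$, if there are Turing functionals $\Phi$ and $\Psi$ such that for every instance $X$ of $\mathsf P$, $\Phi^X$ is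 (the characteristic function of) an instance of $\mathsf Q$, and for every solution $Y$ of this instance, $\Psi^Y$ is (the characteristic function of) a solution to $X$. **Theorem.** $\mathsf{SCAC}\not\le_{\mathrm{sW}}\omega\text{-}\mathsf{SCAC}$. -/

import Mathlib

namespace CompRed

/-- Programs for Turing functionals: codes for partial recursive functions with an extra
instruction that queries an oracle. -/
inductive OracleCode : Type
  | zero : OracleCode
  | succ : OracleCode
  | left : OracleCode
  | right : OracleCode
  | oracle : OracleCode
  | pair : OracleCode → OracleCode → OracleCode
  | comp : OracleCode → OracleCode → OracleCode
  | prec : OracleCode → OracleCode → OracleCode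
  | rfind : OracleCode → OracleCode

/-- The partial function computed by a code relative to the oracle `g`. The clauses are those of
`Nat.RecursiveIn {g}`, so the functions `c.eval g` are exactly the functions that are recursive
in `g`. -/
def OracleCode.eval (g : ℕ →. ℕ) : OracleCode → ℕ →. ℕ
  | zero => fun _ => 0
  | succ => Nat.succ
  | left => fun n => ((Nat.unpair n).1 : ℕ)
  | right => fun n => ((Nat.unpair n).2 : ℕ)
  | oracle => g
  | pair c d => fun n => Nat.pair <$> c.eval g n <*> d.eval g n
  | comp c d => fun n => d.eval g n >>= c.eval g
  | prec c d => fun p =>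
      let (a, n) := Nat.unpair p
      n.rec (c.eval g a) fun y IH => do
        let i ← IH
        d.eval g (Nat.pair a (Nat.pair y i))
  | rfind c => fun a => Nat.rfind fun n => (fun m => m = 0) <$> c.eval g (Nat.pair a n)

open Classical in
/-- The characteristic function of a set of natural numbers. -/
noncomputable def charFun (A : Set ℕ) (n : ℕ) : ℕ := if n ∈ A then 1 else 0

/-- `Φ.Defines X Z`: `Φ^X` is total and is the characteristic function of `Z`. -/
def OracleCode.Defines (Φ : OracleCode) (X Z : Set ℕ) : Prop :=
  ∀ n, Φ.eval (fun k => Part.some (charFun X k)) n = Part.some (charFun Z n)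

/-- Instance-solution problems whose instances and solutions are sets of natural numbers. -/
structure Problem where
  IsInstance : Set ℕ → Prop
  IsSolution : Set ℕ → Set ℕ → Prop

/-- The restriction of a problem to the instances that satisfy `C`. -/
def Problem.restrict (P : Problem) (C : Set ℕ → Prop) : Problem where
  IsInstance X := P.IsInstance X ∧ C X
  IsSolution := P.IsSolution

/-- Strong Weihrauch reducibility: the backward functional `Ψ` sees only the solution `Y`. -/
def StrongWeihrauchReducible (P Q : Problem) : Prop :=
  ∃ Φ Ψ : OracleCode, ∀ X, P.IsInstance X →
    ∃ Z, Φ.Defines X Z ∧ Q.IsInstance Z ∧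
      ∀ Y, Q.IsSolution Z Y → ∃ W, Ψ.Defines Y W ∧ P.IsSolution X W

/-! A structure `(P, ≤_P)` with `P ⊆ ℕ` is coded by the join `P ⊕ ≤_P`, that is, by the set
`{2 x : x ∈ P} ∪ {2 ⟨x, y⟩ + 1 : x ≤_P y}`. -/

/-- The underlying set of the structure coded by `X`. -/
def carrier (X : Set ℕ) : Set ℕ := {x | 2 * x ∈ X}

/-- The binary relation of the structure coded by `X`. -/
def rel (X : Set ℕ) (x y : ℕ) : Prop := 2 * Nat.pair x y + 1 ∈ X

/-- `X` codes a partially ordered set. -/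
structure IsPoset (X : Set ℕ) : Prop where
  mem_carrier : ∀ x y, rel X x y → x ∈ carrier X ∧ y ∈ carrier X
  refl : ∀ x ∈ carrier X, rel X x x
  antisymm : ∀ x y, rel X x y → rel X y x → x = y
  trans : ∀ x y z, rel X x y → rel X y z → rel X x z

/-- `x` lies below all but finitely many elements. -/
def IsSmall (X : Set ℕ) (x : ℕ) : Prop := {y ∈ carrier X | ¬ rel X x y}.Finite

/-- `x` lies above all but finitely many elements. -/
def IsLarge (X : Set ℕ) (x : ℕ) : Prop := {y ∈ carrier X | ¬ rel X y x}.Finite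

/-- `x` is incomparable with all but finitely many elements. -/
def IsIsolated (X : Set ℕ) (x : ℕ) : Prop :=
  {y ∈ carrier X | rel X x y ∨ rel X y x}.Finite

def IsStable (X : Set ℕ) : Prop :=
  (∀ x ∈ carrier X, IsSmall X x ∨ IsIsolated X x) ∨
  (∀ x ∈ carrier X, IsLarge X x ∨ IsIsolated X x)

/-- The order is contained in the usual order of the natural numbers. -/
def IsOmegaOrdered (X : Set ℕ) : Prop := ∀ x y, rel X x y → x ≤ y

/-- The chain-antichain principle. -/
def CAC : Problem where
  IsInstance X := IsPoset X ∧ (carrier X).Infinite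
  IsSolution X Y :=
    Y ⊆ carrier X ∧ Y.Infinite ∧ (IsChain (rel X) Y ∨ IsAntichain (rel X) Y)

/-- The chain-antichain principle for stable posets. -/
def SCAC : Problem := CAC.restrict IsStable

/-- The chain-antichain principle for `ω`-ordered stable posets. -/
def omegaSCAC : Problem := CAC.restrict fun X => IsOmegaOrdered X ∧ IsStable X

end CompRed

/-!
Suppose that `Φ` and `Ψ` witness the reduction. Only their continuity is used: every value of a
functional depends on finitely many bits of its oracle (`OracleCode.eval_continuous`).

Instances are built by forcing with finite partial orders on an initial segment of `ℕ` in which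
every element carries a promise to become isolated or to become small (in the reversed order:
large). For a condition, let `Z` be the `ω`-ordered instance that `Φ` computes from a generic
extension. No element of `Z` is large, so each is small or isolated, and a finite chain of small
elements (a finite antichain of isolated ones) extends to a solution as soon as `Z` has infinitely
many small (isolated) elements. Both kinds of elements can be forced beyond any bound
(`ContReduction.exists_forces_color`): otherwise almost all elements of `Z` have the same kind, a
finite part `E` of a solution already makes `Ψ` put two elements `a`, `c` into its answer, and the
promise about `a` can be changed so that `a` and `c` are in no common solution, although `E` still
extends to a solution.

Now take a generic order `r` with infinitely many small and infinitely many isolated elements in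
`Z`, a finite chain `E₁` of small elements from which `Ψ` computes `a`, `b`, and a finite antichain
`E₂` above `E₁` from which `Ψ` computes `c`, `d`. Keep a long finite part of `r`, forget all
promises, and make new ones that spoil both pairs: the first element of a pair is to be isolated
if the pair is comparable, and not isolated if it is incomparable. To make `c` non-isolated while
`a` stays free, `c` is made large, which is where the reversed orders are needed; had `c` been made
small, `a` could be forced to be small as well. In a generic extension of the new condition, `E₁`
does not extend to a chain, so one of its elements is isolated. The elements of `E₂` lie above it,
so they are isolated by transitivity, `E₂` extends to an infinite antichain, and `Ψ` computes a
wrong answer from it (`ContReduction.false_of_chain_below_antichain`).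
-/

namespace CompRed

/-! ### The use principle -/

theorem OracleCode.eval_continuous (c : OracleCode) (g : ℕ →. ℕ) :
    ∀ n v, v ∈ c.eval g n →
      ∃ u, ∀ g' : ℕ →. ℕ, (∀ k < u, g' k = g k) → v ∈ c.eval g' n := by
  induction c with
  | zero => exact fun n v h => ⟨0, fun _ _ => h⟩
  | succ => exact fun n v h => ⟨0, fun _ _ => h⟩
  | left => exact fun n v h => ⟨0, fun _ _ => h⟩
  | right => exact fun n v h => ⟨0, fun _ _ => h⟩
  | oracle =>
    intro n v h
    refine ⟨n + 1, fun g' hg => ?_⟩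
    simp only [OracleCode.eval] at h ⊢
    rw [hg n n.lt_succ_self]
    exact h
  | pair c d hc hd =>
    intro n v h
    simp only [OracleCode.eval, Seq.seq, Part.map_eq_map, Part.mem_bind_iff, Part.mem_map_iff] at h ⊢
    obtain ⟨_, ⟨x, hx, rfl⟩, y, hy, rfl⟩ := h
    obtain ⟨u₁, h₁⟩ := hc n x hx
    obtain ⟨u₂, h₂⟩ := hd n y hy
    refine ⟨max u₁ u₂, fun g' hg => ⟨_, ⟨x, h₁ g' fun k hk => hg k ?_, rfl⟩, y,
      h₂ g' fun k hk => hg k ?_, rfl⟩⟩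
    · exact lt_max_of_lt_left hk
    · exact lt_max_of_lt_right hk
  | comp c d hc hd =>
    intro n v h
    obtain ⟨x, hx, hv⟩ := Part.mem_bind_iff.1 h
    obtain ⟨u₁, h₁⟩ := hd n x hx
    obtain ⟨u₂, h₂⟩ := hc x v hv
    refine ⟨max u₁ u₂, fun g' hg => Part.mem_bind_iff.2 ⟨x, h₁ g' fun k hk => hg k ?_,
      h₂ g' fun k hk => hg k ?_⟩⟩
    · exact lt_max_of_lt_left hk
    · exact lt_max_of_lt_right hk
  | prec c d hc hd =>
    intro p v h
    simp only [OracleCode.eval] at h ⊢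
    generalize (Nat.unpair p).1 = a at h ⊢
    generalize (Nat.unpair p).2 = n at h ⊢
    induction n generalizing v with
    | zero => exact hc a v h
    | succ n ih =>
      simp only [Part.bind_eq_bind, Part.mem_bind_iff] at h ⊢
      obtain ⟨i, hi, hv⟩ := h
      obtain ⟨u₁, h₁⟩ := ih i hi
      obtain ⟨u₂, h₂⟩ := hd _ v hv
      refine ⟨max u₁ u₂, fun g' hg => ⟨i, h₁ g' fun k hk => hg k ?_,
        h₂ g' fun k hk => hg k ?_⟩⟩
      · exact lt_max_of_lt_left hk
      · exact lt_max_of_lt_right hk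
  | rfind c hc =>
    intro a v h
    obtain ⟨h₀, hlt⟩ := Nat.mem_rfind.1 h
    obtain ⟨x, hx, hx0⟩ := (Part.mem_map_iff _).1 h₀
    obtain ⟨u, hu⟩ := hc _ x hx
    have key : ∀ m, ∃ w, m < v → ∀ g' : ℕ →. ℕ, (∀ k < w, g' k = g k) →
        ∃ y ∈ c.eval g' (Nat.pair a m), decide (y = 0) = false := by
      intro m
      by_cases hm : m < v
      · obtain ⟨y, hy, hy0⟩ := (Part.mem_map_iff _).1 (hlt hm)
        obtain ⟨w, hw⟩ := hc _ y hy
        exact ⟨w, fun _ g' hg => ⟨y, hw g' hg, hy0⟩⟩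
      · exact ⟨0, fun h => absurd h hm⟩
    choose w hw using key
    refine ⟨max u ((Finset.range v).sup w), fun g' hg =>
      Nat.mem_rfind.2 ⟨(Part.mem_map_iff _).2
        ⟨x, hu g' fun k hk => hg k (lt_max_of_lt_left hk), hx0⟩, fun {m} hm =>
        (Part.mem_map_iff _).2 (hw m hm g' fun k hk =>
          hg k (lt_max_of_lt_right (hk.trans_le ?_)))⟩⟩
    exact Finset.le_sup (f := w) (Finset.mem_range.2 hm)

/-- The set of inputs on which the functional, with oracle `X`, takes the value `1`. -/
def OracleCode.output (Φ : OracleCode) (X : Set ℕ) : Set ℕ :=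
  {k | 1 ∈ Φ.eval (fun j => Part.some (charFun X j)) k}

theorem OracleCode.Defines.output_eq {Φ : OracleCode} {X Z : Set ℕ} (h : Φ.Defines X Z) :
    Φ.output X = Z := by
  ext k
  change 1 ∈ Φ.eval _ k ↔ _
  rw [h k]
  by_cases hk : k ∈ Z <;> simp [charFun, hk]

theorem charFun_congr {X X' : Set ℕ} {k : ℕ} (h : k ∈ X ↔ k ∈ X') :
    charFun X' k = charFun X k := by
  unfold charFun
  by_cases hk : k ∈ X
  · rw [if_pos hk, if_pos (h.1 hk)]
  · rw [if_neg hk, if_neg (mt h.2 hk)]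

theorem OracleCode.output_continuous {Φ : OracleCode} {X : Set ℕ} {k : ℕ} (h : k ∈ Φ.output X) :
    ∃ u, ∀ X' : Set ℕ, (∀ j < u, j ∈ X ↔ j ∈ X') → k ∈ Φ.output X' := by
  obtain ⟨u, hu⟩ := Φ.eval_continuous _ k 1 h
  exact ⟨u, fun X' hX => hu _ fun j hj => by rw [charFun_congr (hX j hj)]⟩

theorem OracleCode.Defines.output_continuous {Φ : OracleCode} {X Z : Set ℕ}
    (h : Φ.Defines X Z) (k : ℕ) :
    ∃ u, ∀ X' : Set ℕ, (∀ j < u, j ∈ X ↔ j ∈ X') → (k ∈ Φ.output X ↔ k ∈ Φ.output X') := by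
  obtain ⟨u, hu⟩ := Φ.eval_continuous (fun j => Part.some (charFun X j)) k (charFun Z k)
    (by rw [h k]; exact Part.mem_some _)
  refine ⟨u, fun X' hX => ?_⟩
  have h' := hu (fun j => Part.some (charFun X' j))
    fun j hj => by rw [charFun_congr (hX j hj)]
  have e : Φ.eval (fun j => Part.some (charFun X j)) k =
      Φ.eval (fun j => Part.some (charFun X' j)) k := by
    rw [h k, Part.eq_some_iff.2 h']
  change 1 ∈ Φ.eval _ k ↔ 1 ∈ Φ.eval _ k
  rw [e]

/-! ### Stable orders on the natural numbers and forcing conditions -/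

/-- A partial order on all of `ℕ` in which every element is small or isolated. -/
structure StableOrder (r : ℕ → ℕ → Prop) : Prop where
  refl : ∀ x, r x x
  antisymm : ∀ x y, r x y → r y x → x = y
  trans : ∀ x y z, r x y → r y z → r x z
  stable : ∀ x, (∃ k, ∀ y ≥ k, r x y) ∨ ∃ k, ∀ y ≥ k, ¬ r x y ∧ ¬ r y x

/-- From `n` on, every number lies above the elements of `B` below `n` and is incomparable with
the other numbers below `n`. -/
def Obeys (r : ℕ → ℕ → Prop) (n : ℕ) (B : Set ℕ) : Prop :=
  ∀ x < n, ∀ y ≥ n, (r x y ↔ x ∈ B) ∧ ¬ r y x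

/-- A forcing condition: a partial order on `{0, …, n - 1}` together with the promise that the
elements of `big` will be small and the others isolated. The order is given by a partial order
`r` on `ℕ` that keeps the promise; only its part below `n` and `big` below `n` matter. -/
structure Cond where
  n : ℕ
  r : ℕ → ℕ → Prop
  big : Set ℕ
  refl : ∀ x, r x x
  antisymm : ∀ x y, r x y → r y x → x = y
  trans : ∀ x y z, r x y → r y z → r x z
  obeys : Obeys r n big

/-- The order `r` extends the finite order of `p` and keeps its promises. -/
def Cond.Sat (p : Cond) (r : ℕ → ℕ → Prop) : Prop :=
  (∀ x < p.n, ∀ y < p.n, r x y ↔ p.r x y) ∧ Obeys r p.n p.big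

/-- `q` is a stronger condition than `p`. -/
def Cond.Ext (p q : Cond) : Prop :=
  p.n ≤ q.n ∧ p.Sat q.r ∧ ∀ x < p.n, x ∈ q.big ↔ x ∈ p.big

theorem Cond.sat_self (p : Cond) : p.Sat p.r := ⟨fun _ _ _ _ => Iff.rfl, p.obeys⟩

theorem Cond.Ext.refl (p : Cond) : p.Ext p := ⟨le_rfl, p.sat_self, fun _ _ => Iff.rfl⟩

theorem Cond.Ext.sat {p q : Cond} (h : p.Ext q) {r : ℕ → ℕ → Prop} (hr : q.Sat r) : p.Sat r := by
  obtain ⟨hn, ⟨h₁, h₂⟩, h₃⟩ := h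
  refine ⟨fun x hx y hy => (hr.1 x (by omega) y (by omega)).trans (h₁ x hx y hy),
    fun x hx y hy => ?_⟩
  by_cases hyq : y < q.n
  · rw [hr.1 x (by omega) y hyq, hr.1 y hyq x (by omega)]
    exact h₂ x hx y hy
  · rw [← h₃ x hx]
    exact hr.2 x (by omega) y (by omega)

theorem Cond.Ext.trans {p q s : Cond} (h : p.Ext q) (h' : q.Ext s) : p.Ext s :=
  ⟨h.1.trans h'.1, h.sat h'.2.1, fun x hx =>
    (h'.2.2 x (lt_of_lt_of_le hx h.1)).trans (h.2.2 x hx)⟩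

/-- The condition with the order `r` below `N` and the promises `B`. Beyond `N` its order is
an antichain above `B`. -/
def Cond.trunc (r : ℕ → ℕ → Prop)
    (hanti : ∀ x y, r x y → r y x → x = y) (htrans : ∀ x y z, r x y → r y z → r x z)
    (N : ℕ) (B : Set ℕ) (hB : ∀ x < N, ∀ y < N, r x y → y ∈ B → x ∈ B) : Cond where
  n := N
  r x y := x = y ∨ x < N ∧ (y < N ∧ r x y ∨ N ≤ y ∧ x ∈ B)
  big := B
  refl x := Or.inl rfl
  antisymm x y := by
    rintro (h | ⟨h₁, h₂⟩) (h' | ⟨h₃, h₄⟩)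
    · exact h
    · exact h
    · exact h'.symm
    · rcases h₂ with h₂ | h₂
      · rcases h₄ with h₄ | h₄
        · exact hanti x y h₂.2 h₄.2
        · omega
      · omega
  trans x y z := by
    rintro (rfl | ⟨h₁, h₂⟩) h
    · exact h
    · rcases h with rfl | ⟨h₃, h₄⟩
      · exact Or.inr ⟨h₁, h₂⟩
      · rcases h₂ with h₂ | h₂
        · rcases h₄ with h₄ | h₄
          · exact Or.inr ⟨h₁, Or.inl ⟨h₄.1, htrans x y z h₂.2 h₄.2⟩⟩
          · exact Or.inr ⟨h₁, Or.inr ⟨h₄.1, hB x h₁ y h₃ h₂.2 h₄.2⟩⟩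
        · omega
  obeys x hx y hy := by
    refine ⟨⟨?_, fun h => Or.inr ⟨hx, Or.inr ⟨hy, h⟩⟩⟩, ?_⟩
    · rintro (h | ⟨_, h | h⟩)
      · omega
      · omega
      · exact h.2
    · rintro (h | ⟨h, _⟩) <;> omega

theorem Cond.exists_cond {r : ℕ → ℕ → Prop} (hrefl : ∀ x, r x x)
    (hanti : ∀ x y, r x y → r y x → x = y) (htrans : ∀ x y z, r x y → r y z → r x z)
    (N : ℕ) (B : Set ℕ) (hB : ∀ x < N, ∀ y < N, r x y → y ∈ B → x ∈ B) :
    ∃ q : Cond, q.n = N ∧ q.big = B ∧ ∀ x < q.n, ∀ y < q.n, q.r x y ↔ r x y := by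
  refine ⟨Cond.trunc r hanti htrans N B hB, rfl, rfl, fun x hx y hy =>
    ⟨?_, fun h => Or.inr ⟨hx, Or.inl ⟨hy, h⟩⟩⟩⟩
  rintro (rfl | ⟨_, h | h⟩)
  · exact hrefl x
  · exact h.2
  · exact absurd hy (not_lt.2 h.1)

theorem Cond.Sat.ext {p q : Cond} {r : ℕ → ℕ → Prop} (hp : p.Sat r) (hn : p.n ≤ q.n)
    (hqr : ∀ x < q.n, ∀ y < q.n, q.r x y ↔ r x y) (hb : ∀ x < p.n, x ∈ q.big ↔ x ∈ p.big) :
    p.Ext q := by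
  refine ⟨hn, ⟨fun x hx y hy => ?_, fun x hx y hy => ?_⟩, hb⟩
  · rw [hqr x (by omega) y (by omega)]
    exact hp.1 x hx y hy
  · by_cases hyN : y < q.n
    · rw [hqr x (by omega) y hyN, hqr y hyN x (by omega)]
      exact hp.2 x hx y hy
    · rw [← hb x hx]
      exact q.obeys x (by omega) y (not_lt.1 hyN)

theorem Cond.Sat.mem_big {p : Cond} {r : ℕ → ℕ → Prop} (hp : p.Sat r)
    (htrans : ∀ x y z, r x y → r y z → r x z) {x y : ℕ} (hxy : r x y) (hy : y < p.n)
    (hyb : y ∈ p.big) : x < p.n ∧ x ∈ p.big := by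
  have hx : x < p.n := by
    by_contra hx
    exact (hp.2 y hy x (not_lt.1 hx)).2 hxy
  exact ⟨hx, (hp.2 x hx p.n le_rfl).1.1
    (htrans x y p.n hxy ((hp.2 y hy p.n le_rfl).1.2 hyb))⟩

/-- Every order that satisfies a condition can be cut off arbitrarily late, with all new elements
promised to be isolated. -/
theorem Cond.exists_ext_of_sat {p : Cond} {r : ℕ → ℕ → Prop} (hrefl : ∀ x, r x x)
    (hanti : ∀ x y, r x y → r y x → x = y) (htrans : ∀ x y z, r x y → r y z → r x z)
    (hp : p.Sat r) (N : ℕ) :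
    ∃ q, p.Ext q ∧ N ≤ q.n ∧ ∀ x < q.n, ∀ y < q.n, q.r x y ↔ r x y := by
  have hB : ∀ x < max N p.n, ∀ y < max N p.n, r x y →
      y ∈ {x | x < p.n ∧ x ∈ p.big} → x ∈ {x | x < p.n ∧ x ∈ p.big} := by
    rintro x - y - hxy ⟨hy, hyb⟩
    exact hp.mem_big htrans hxy hy hyb
  obtain ⟨q, hqn, hqb, hqr⟩ := Cond.exists_cond hrefl hanti htrans _ _ hB
  refine ⟨q, hp.ext (by omega) hqr fun x hx => ?_, by omega, hqr⟩
  rw [hqb]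
  exact ⟨fun h => h.2, fun h => ⟨hx, h⟩⟩

/-- For countably many dense sets of conditions below `p` there is a stable order that satisfies
a condition from each of them. -/
theorem Cond.exists_generic (p : Cond) (D : ℕ → Cond → Prop)
    (hD : ∀ k q, p.Ext q → ∃ q', q.Ext q' ∧ D k q') :
    ∃ r, StableOrder r ∧ p.Sat r ∧ ∀ k, ∃ q, D k q ∧ q.Sat r := by
  have step : ∀ (k : ℕ) (q : {q // p.Ext q}), ∃ q' : {q // p.Ext q},
      q.1.Ext q'.1 ∧ q.1.n < q'.1.n ∧ D k q'.1 := by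
    rintro k ⟨q, hq⟩
    obtain ⟨q₁, h₁, hn, -⟩ :=
      Cond.exists_ext_of_sat q.refl q.antisymm q.trans q.sat_self (q.n + 1)
    obtain ⟨q₂, h₂, hk⟩ := hD k q₁ (hq.trans h₁)
    exact ⟨⟨q₂, hq.trans (h₁.trans h₂)⟩, h₁.trans h₂, lt_of_lt_of_le hn h₂.1, hk⟩
  choose f hf using step
  let P : ℕ → {q // p.Ext q} := fun k => Nat.rec ⟨p, Cond.Ext.refl p⟩ (fun k q => f k q) k
  have hP : ∀ k, (P k).1.Ext (P (k + 1)).1 ∧ (P k).1.n < (P (k + 1)).1.n ∧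
      D k (P (k + 1)).1 := fun k => hf k (P k)
  have hmono : ∀ j k, j ≤ k → (P j).1.Ext (P k).1 := by
    intro j k hjk
    induction k, hjk using Nat.le_induction with
    | base => exact Cond.Ext.refl _
    | succ k _ ih => exact ih.trans (hP k).1
  have hn : ∀ k, k ≤ (P k).1.n := by
    intro k
    induction k with
    | zero => exact Nat.zero_le _
    | succ k ih => exact Nat.succ_le_of_lt (lt_of_le_of_lt ih (hP k).2.1)
  let r : ℕ → ℕ → Prop := fun x y => (P (max x y + 1)).1.r x y
  have hagree : ∀ k x y, x < k → y < k → (r x y ↔ (P k).1.r x y) := by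
    intro k x y hx hy
    have h := hn (max x y + 1)
    exact ((hmono (max x y + 1) k (by omega)).2.1.1 x (by omega) y (by omega)).symm
  have hsat : ∀ k, (P k).1.Sat r := by
    intro k
    refine ⟨fun x hx y hy => ?_, fun x hx y hy => ?_⟩
    · rw [hagree (max k (max x y + 1)) x y (by omega) (by omega)]
      exact (hmono k _ (le_max_left _ _)).2.1.1 x hx y hy
    · rw [hagree (max k (max x y + 1)) x y (by omega) (by omega),
        hagree (max k (max x y + 1)) y x (by omega) (by omega)]
      exact (hmono k _ (le_max_left _ _)).2.1.2 x hx y hy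
  refine ⟨r, ⟨fun x => Cond.refl _ x, fun x y hxy hyx => ?_, fun x y z hxy hyz => ?_,
    fun x => ?_⟩, hsat 0, fun k => ⟨_, (hP k).2.2, hsat (k + 1)⟩⟩
  · rw [hagree (max x y + 1) x y (by omega) (by omega)] at hxy
    rw [hagree (max x y + 1) y x (by omega) (by omega)] at hyx
    exact Cond.antisymm _ x y hxy hyx
  · rw [hagree (max x (max y z) + 1) _ _ (by omega) (by omega)] at hxy hyz ⊢
    exact Cond.trans _ x y z hxy hyz
  · have hx : x < (P (x + 1)).1.n := hn (x + 1)
    have h := (hsat (x + 1)).2 x hx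
    by_cases hb : x ∈ (P (x + 1)).1.big
    · exact Or.inl ⟨_, fun y hy => (h y hy).1.2 hb⟩
    · exact Or.inr ⟨_, fun y hy => ⟨fun hxy => hb ((h y hy).1.1 hxy), (h y hy).2⟩⟩

/-- If the promise made about `a` contradicts the comparability of `a` and `b`, then `a` and `b`
do not lie in a common solution. -/
theorem Cond.Sat.not_solution {p : Cond} {r : ℕ → ℕ → Prop} (hr : p.Sat r) {a b : ℕ}
    (ha : a < p.n) (hb : b < p.n) (hab : a ≠ b) (hbig : a ∈ p.big ↔ ¬ (p.r a b ∨ p.r b a))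
    {W : Set ℕ} (haW : a ∈ W) (hbW : b ∈ W) (hW : W.Infinite)
    (h : IsChain r W ∨ IsAntichain r W) : False := by
  rw [← hr.1 a ha b hb, ← hr.1 b hb a ha] at hbig
  obtain ⟨y, hy, hny⟩ := hW.exists_gt p.n
  have hya : a ≠ y := by omega
  have hay := hr.2 a ha y hny.le
  rcases h with h | h
  · have hna : a ∉ p.big := fun ha' => hbig.1 ha' (h haW hbW hab)
    exact (h haW hy hya).elim (fun h' => hna (hay.1.1 h')) hay.2
  · refine h haW hy hya (hay.1.2 (hbig.2 ?_))
    exact not_or.2 ⟨h haW hbW hab, h hbW haW hab.symm⟩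

/-! ### Homogeneous sets in `ω`-ordered stable posets -/

/-- The element `z` is small (for `b = true`) or isolated (for `b = false`) in the `ω`-ordered
poset coded by `Z`: its relation to almost all later elements is `b`. -/
def Color (Z : Set ℕ) (b : Bool) (z : ℕ) : Prop :=
  ∃ k, ∀ w ≥ k, w ∈ carrier Z → (rel Z z w ↔ b = true)

theorem color_or {Z : Set ℕ} (hZ : omegaSCAC.IsInstance Z) {z : ℕ} (hz : z ∈ carrier Z)
    (b : Bool) : Color Z b z ∨ Color Z (!b) z := by
  obtain ⟨⟨hpo, hinf⟩, hom, hst⟩ := hZ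
  have key : Color Z true z ∨ Color Z false z := by
    have bound : ∀ S : Set ℕ, S.Finite → ∃ k, ∀ w ≥ k, w ∉ S := by
      intro S hS
      obtain ⟨k, hk⟩ := hS.bddAbove
      exact ⟨k + 1, fun w hw hwS => by have := hk hwS; omega⟩
    have hiso : IsIsolated Z z → Color Z false z := by
      intro h
      obtain ⟨k, hk⟩ := bound _ h
      exact ⟨k, fun w hw hwZ => by
        simpa using fun hzw => hk w hw ⟨hwZ, Or.inl hzw⟩⟩
    rcases hst with hst | hst
    · rcases hst z hz with h | h
      · obtain ⟨k, hk⟩ := bound _ h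
        refine Or.inl ⟨k, fun w hw hwZ => ?_⟩
        simpa using not_not.1 fun hzw => hk w hw ⟨hwZ, hzw⟩
      · exact Or.inr (hiso h)
    · rcases hst z hz with h | h
      · -- In an `ω`-ordered poset no element lies above infinitely many others.
        obtain ⟨k, hk⟩ := bound _ h
        obtain ⟨w, hw, hlt⟩ := hinf.exists_gt (max k z)
        refine absurd ⟨hw, fun hwz => ?_⟩ (hk w (by omega))
        have := hom w z hwz
        omega
      · exact Or.inr (hiso h)
  cases b
  · exact key.symm
  · exact key

/-- The set `E` is a chain (for `b = true`) or an antichain (for `b = false`) in the `ω`-ordered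
poset coded by `Z`. -/
def IsHomogeneous (Z : Set ℕ) (b : Bool) (E : Set ℕ) : Prop :=
  E ⊆ carrier Z ∧ ∀ x ∈ E, ∀ y ∈ E, x < y → (rel Z x y ↔ b = true)

/-- If there are infinitely many elements of colour `b`, then every finite homogeneous set of
elements of colour `b` is an initial segment of a solution. -/
theorem exists_solution {Z : Set ℕ} (hZ : omegaSCAC.IsInstance Z) {b : Bool}
    (hinf : {z | z ∈ carrier Z ∧ Color Z b z}.Infinite) {E : Set ℕ} {u : ℕ}
    (hEu : ∀ e ∈ E, e < u) (hEc : ∀ e ∈ E, Color Z b e) (hE : IsHomogeneous Z b E) :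
    ∃ Y, omegaSCAC.IsSolution Z Y ∧ (∀ k < u, k ∈ E ↔ k ∈ Y) ∧ (∀ y ∈ Y, Color Z b y) ∧
      IsHomogeneous Z b Y := by
  obtain ⟨hEZ, hEh⟩ := hE
  have hEfin : E.Finite := (Set.finite_lt_nat u).subset hEu
  have bound : ∀ S : Finset ℕ, (∀ x ∈ S, Color Z b x) →
      ∃ k, ∀ x ∈ S, ∀ w ≥ k, w ∈ carrier Z → (rel Z x w ↔ b = true) := by
    intro S hS
    choose! k hk using hS
    exact ⟨S.sup k, fun x hx w hw => hk x hx w ((Finset.le_sup hx).trans hw)⟩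
  obtain ⟨k₀, hk₀⟩ := bound hEfin.toFinset (fun x hx => hEc x (hEfin.mem_toFinset.1 hx))
  obtain ⟨f, hf, hff⟩ := exists_seq_of_forall_finset_exists
    (fun y => (y ∈ carrier Z ∧ Color Z b y) ∧ u ≤ y ∧ ∀ e ∈ E, (rel Z e y ↔ b = true))
    (fun x y => x < y ∧ (rel Z x y ↔ b = true)) (by
      intro S hS
      obtain ⟨k₁, hk₁⟩ := bound S fun x hx => (hS x hx).1.2
      obtain ⟨y, hy, hlt⟩ := hinf.exists_gt (max (max k₀ u) (max k₁ (S.sup id)))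
      refine ⟨y, ⟨hy, by omega, fun e he =>
        hk₀ e (hEfin.mem_toFinset.2 he) y (by omega) hy.1⟩, fun x hx => ⟨?_, ?_⟩⟩
      · have : x ≤ S.sup id := Finset.le_sup (f := id) hx
        omega
      · exact hk₁ x hx y (by omega) hy.1)
  have hmono : StrictMono f := fun m n h => (hff m n h).1
  have hhom : ∀ x ∈ E ∪ Set.range f, ∀ y ∈ E ∪ Set.range f, x < y →
      (rel Z x y ↔ b = true) := by
    rintro x (hx | ⟨i, rfl⟩) y (hy | ⟨j, rfl⟩) hxy
    · exact hEh x hx y hy hxy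
    · exact (hf j).2.2 x hx
    · have := hEu y hy
      have := (hf i).2.1
      omega
    · exact (hff i j (hmono.lt_iff_lt.1 hxy)).2
  have hsub : E ∪ Set.range f ⊆ carrier Z := by
    rintro x (hx | ⟨i, rfl⟩)
    · exact hEZ hx
    · exact (hf i).1.1
  refine ⟨E ∪ Set.range f, ⟨hsub, ?_, ?_⟩, ?_, ?_, hsub, hhom⟩
  · exact (Set.infinite_range_of_injective hmono.injective).mono Set.subset_union_right
  · cases b
    · refine Or.inr fun x hx y hy hxy hr => ?_
      rcases lt_or_gt_of_ne hxy with h | h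
      · simpa using (hhom x hx y hy h).1 hr
      · have := hZ.2.1 x y hr
        omega
    · refine Or.inl fun x hx y hy hxy => ?_
      rcases lt_or_gt_of_ne hxy with h | h
      · exact Or.inl ((hhom x hx y hy h).2 rfl)
      · exact Or.inr ((hhom y hy x hx h).2 rfl)
  · refine fun k hk => ⟨Or.inl, ?_⟩
    rintro (h | ⟨i, rfl⟩)
    · exact h
    · have := (hf i).2.1
      omega
  · rintro x (hx | ⟨i, rfl⟩)
    · exact hEc x hx
    · exact (hf i).1.2

/-- The poset coded by `Z`, restricted to `{0, …, U - 1}`, is determined by finitely many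
elements of `Z`. -/
theorem exists_coding_bound (U : ℕ) : ∃ K, ∀ Z Z' : Set ℕ, (∀ k < K, k ∈ Z ↔ k ∈ Z') →
    ∀ x < U, (x ∈ carrier Z ↔ x ∈ carrier Z') ∧ ∀ y < U, (rel Z x y ↔ rel Z' x y) := by
  refine ⟨2 * Nat.pair U U + 2 * U + 2, fun Z Z' h x hx => ⟨h _ (by omega), fun y hy => h _ ?_⟩⟩
  have h₁ : Nat.pair x y < Nat.pair U y := Nat.pair_lt_pair_left y hx
  have h₂ : Nat.pair U y < Nat.pair U U := Nat.pair_lt_pair_right U hy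
  omega

/-! ### Continuous reductions and richness -/

/-- `F` and `G` are the forward and backward functionals of a reduction of the problem of finding
infinite chains or antichains in stable orders on `ℕ` to `omegaSCAC`; all that is kept of their
computability is continuity. -/
structure ContReduction (F : (ℕ → ℕ → Prop) → Set ℕ) (G : Set ℕ → Set ℕ) : Prop where
  inst : ∀ r, StableOrder r → omegaSCAC.IsInstance (F r)
  sol : ∀ r, StableOrder r → ∀ Y, omegaSCAC.IsSolution (F r) Y →
    (G Y).Infinite ∧ (IsChain r (G Y) ∨ IsAntichain r (G Y))
  cont : ∀ r, StableOrder r → ∀ k, ∃ N, ∀ r' : ℕ → ℕ → Prop,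
    (∀ x < N, ∀ y < N, r x y ↔ r' x y) → (k ∈ F r ↔ k ∈ F r')
  cont_back : ∀ Y, ∀ k ∈ G Y, ∃ u, ∀ Y', (∀ j < u, j ∈ Y ↔ j ∈ Y') → k ∈ G Y'

variable {F : (ℕ → ℕ → Prop) → Set ℕ} {G : Set ℕ → Set ℕ}

/-- The condition `p` forces the property `φ` of the instance computed by `F`. -/
def Cond.Forces (F : (ℕ → ℕ → Prop) → Set ℕ) (p : Cond) (φ : Set ℕ → Prop) : Prop :=
  ∀ r, StableOrder r → p.Sat r → φ (F r)

theorem ContReduction.cont_lt (H : ContReduction F G) {r : ℕ → ℕ → Prop} (hr : StableOrder r)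
    (K : ℕ) : ∃ N, ∀ r' : ℕ → ℕ → Prop, (∀ x < N, ∀ y < N, r x y ↔ r' x y) →
      ∀ k < K, k ∈ F r ↔ k ∈ F r' := by
  choose N hN using H.cont r hr
  refine ⟨(Finset.range K).sup N, fun r' h k hk => hN k r' fun x hx y hy => ?_⟩
  have hle : N k ≤ (Finset.range K).sup N := Finset.le_sup (Finset.mem_range.2 hk)
  exact h x (by omega) y (by omega)

/-- A property of `F r` that depends on finitely many values is forced by some condition that
agrees with `r`. -/
theorem ContReduction.exists_forces (H : ContReduction F G) {r : ℕ → ℕ → Prop}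
    (hr : StableOrder r) {p : Cond} (hp : p.Sat r) {φ : Set ℕ → Prop} {K : ℕ}
    (hφ : ∀ Z, (∀ k < K, k ∈ F r ↔ k ∈ Z) → φ Z) : ∃ q, p.Ext q ∧ q.Forces F φ := by
  obtain ⟨N, hN⟩ := H.cont_lt hr K
  obtain ⟨q, hpq, hNq, hq⟩ := Cond.exists_ext_of_sat hr.refl hr.antisymm hr.trans hp N
  refine ⟨q, hpq, fun r' _ hsat => hφ _ (hN r' fun x hx y hy => ?_)⟩
  rw [hsat.1 x (by omega) y (by omega), hq x (by omega) y (by omega)]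

/-- If no extension of `p` forces an element beyond `m` to have colour `!b`, then
in some order satisfying `p` all elements beyond `m` have colour `b`. A generic order works: for each
`z ≥ m` and each `k`, a relation `b` of `z` to some `w ≥ k` can be forced (unless `z` can be kept
out of the instance), since otherwise `z` is already forced to have colour `!b`. -/
theorem ContReduction.exists_monochromatic (H : ContReduction F G) {p : Cond} {m : ℕ} {b : Bool}
    (hno : ∀ q, p.Ext q →
      ¬ q.Forces F fun Z => ∃ z ≥ m, z ∈ carrier Z ∧ Color Z (!b) z) :
    ∃ r, StableOrder r ∧ p.Sat r ∧ ∀ z ≥ m, z ∈ carrier (F r) → Color (F r) b z := by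
  obtain ⟨r, hr, hpr, hD⟩ := p.exists_generic
    (fun i q => m ≤ i.unpair.1 → q.Forces F fun Z => i.unpair.1 ∈ carrier Z →
      ∃ w ≥ i.unpair.2, w ∈ carrier Z ∧ (rel Z i.unpair.1 w ↔ b = true)) (by
    intro i q hq
    generalize i.unpair.1 = z
    generalize i.unpair.2 = k
    by_cases hm : m ≤ z
    swap
    · exact ⟨q, Cond.Ext.refl q, fun h => absurd h hm⟩
    by_cases h₁ : ∃ r, StableOrder r ∧ q.Sat r ∧ z ∉ carrier (F r)
    · obtain ⟨r, hr, hqr, hz⟩ := h₁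
      obtain ⟨q', hq', hf⟩ := H.exists_forces hr hqr (φ := fun Z => z ∉ carrier Z)
        (K := 2 * z + 1) fun Z hZ hz' => hz ((hZ _ (by omega)).2 hz')
      exact ⟨q', hq', fun _ r' hr' hs hz' => absurd hz' (hf r' hr' hs)⟩
    by_cases h₂ : ∃ r, StableOrder r ∧ q.Sat r ∧
        ∃ w ≥ k, w ∈ carrier (F r) ∧ (rel (F r) z w ↔ b = true)
    · obtain ⟨r, hr, hqr, w, hw, hwZ, hzw⟩ := h₂
      obtain ⟨K, hK⟩ := exists_coding_bound (max z w + 1)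
      obtain ⟨q', hq', hf⟩ := H.exists_forces hr hqr
        (φ := fun Z => w ∈ carrier Z ∧ (rel Z z w ↔ b = true)) (K := K) fun Z hZ =>
          ⟨(hK _ _ hZ w (by omega)).1.1 hwZ,
            ((hK _ _ hZ z (by omega)).2 w (by omega)).symm.trans hzw⟩
      exact ⟨q', hq', fun _ r' hr' hs _ => ⟨w, hw, hf r' hr' hs⟩⟩
    push Not at h₁ h₂
    refine absurd (fun r hr hs => ⟨z, hm, h₁ r hr hs, k, fun w hw hwZ => ?_⟩) (hno q hq)
    have := h₂ r hr hs w hw hwZ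
    cases b <;> simp_all)
  refine ⟨r, hr, hpr, fun z hz hzZ => ?_⟩
  refine (color_or (H.inst r hr) hzZ b).resolve_right ?_
  rintro ⟨k, hk⟩
  obtain ⟨q, hq, hs⟩ := hD (Nat.pair z k)
  simp only [Nat.unpair_pair] at hq
  obtain ⟨w, hw, hwZ, hzw⟩ := hq hz r hr hs hzZ
  have := hk w hw hwZ
  cases b <;> simp_all

/-- A solution computes a pair of arbitrarily large distinct elements from a finite part of
itself. -/
theorem ContReduction.exists_pair (H : ContReduction F G) {r : ℕ → ℕ → Prop}
    (hr : StableOrder r) {Y : Set ℕ} (hY : omegaSCAC.IsSolution (F r) Y) (n : ℕ) :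
    ∃ a b u E, n ≤ a ∧ n ≤ b ∧ a ≠ b ∧ E ⊆ Y ∧ (∀ e ∈ E, e < u) ∧
      ∀ Y', (∀ j < u, j ∈ E ↔ j ∈ Y') → a ∈ G Y' ∧ b ∈ G Y' := by
  have hW := (H.sol r hr Y hY).1
  obtain ⟨a, ha, hna⟩ := hW.exists_gt n
  obtain ⟨b, hb, hab⟩ := hW.exists_gt a
  obtain ⟨u, hu⟩ := H.cont_back Y a ha
  obtain ⟨v, hv⟩ := H.cont_back Y b hb
  refine ⟨a, b, max u v, {j | j ∈ Y ∧ j < max u v}, hna.le, by omega, hab.ne, fun _ h => h.1,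
    fun _ h => h.2, fun Y' h => ?_⟩
  have h' : ∀ j < max u v, j ∈ Y ↔ j ∈ Y' := fun j hj =>
    ⟨fun hjY => (h j hj).1 ⟨hjY, hj⟩, fun hjY => ((h j hj).2 hjY).1⟩
  exact ⟨hu Y' fun j hj => h' j (by omega), hv Y' fun j hj => h' j (by omega)⟩

/-- If `a` and `b` are computed from the finite homogeneous set `E`, and the promise about `a`
contradicts the comparability of `a` and `b`, then `E` must not extend to a solution: the
elements of `E` cannot all have the right colour. -/
theorem ContReduction.not_all_color (H : ContReduction F G) {r : ℕ → ℕ → Prop}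
    (hr : StableOrder r) {q : Cond} (hq : q.Sat r) {β : Bool}
    (hinf : {z | z ∈ carrier (F r) ∧ Color (F r) β z}.Infinite) {E : Set ℕ} {u a b : ℕ}
    (hEu : ∀ e ∈ E, e < u) (hE : IsHomogeneous (F r) β E)
    (hG : ∀ Y', (∀ j < u, j ∈ E ↔ j ∈ Y') → a ∈ G Y' ∧ b ∈ G Y')
    (ha : a < q.n) (hb : b < q.n) (hab : a ≠ b) (hbig : a ∈ q.big ↔ ¬ (q.r a b ∨ q.r b a)) :
    ¬ ∀ e ∈ E, Color (F r) β e := by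
  intro hEc
  obtain ⟨Y, hY, hEY, -⟩ := exists_solution (H.inst r hr) hinf hEu hEc hE
  obtain ⟨haY, hbY⟩ := hG Y hEY
  obtain ⟨hinfY, hsol⟩ := H.sol r hr Y hY
  exact hq.not_solution ha hb hab hbig haY hbY hinfY hsol

theorem infinite_of_forall_ge_color {Z : Set ℕ} (hZ : omegaSCAC.IsInstance Z) {m : ℕ} {b : Bool}
    (h : ∀ z ≥ m, z ∈ carrier Z → Color Z b z) :
    {z | z ∈ carrier Z ∧ Color Z b z}.Infinite := by
  refine Set.infinite_of_forall_exists_gt fun k => ?_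
  obtain ⟨z, hz, hlt⟩ := hZ.1.2.exists_gt (max k m)
  exact ⟨z, ⟨hz, h z (by omega) hz⟩, by omega⟩

theorem isHomogeneous_empty (Z : Set ℕ) (b : Bool) : IsHomogeneous Z b ∅ :=
  ⟨Set.empty_subset _, fun _ h => h.elim⟩

theorem IsHomogeneous.mono {Z : Set ℕ} {b : Bool} {E E' : Set ℕ} (h : IsHomogeneous Z b E')
    (hE : E ⊆ E') : IsHomogeneous Z b E :=
  ⟨hE.trans h.1, fun x hx y hy => h.2 x (hE hx) y (hE hy)⟩

theorem IsHomogeneous.congr {Z Z' : Set ℕ} {b : Bool} {E : Set ℕ} {u : ℕ}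
    (h : IsHomogeneous Z b E) (hE : ∀ e ∈ E, e < u)
    (hZ : ∀ x < u, (x ∈ carrier Z ↔ x ∈ carrier Z') ∧ ∀ y < u, (rel Z x y ↔ rel Z' x y)) :
    IsHomogeneous Z' b E :=
  ⟨fun x hx => (hZ x (hE x hx)).1.1 (h.1 hx), fun x hx y hy hxy =>
    ((hZ x (hE x hx)).2 y (hE y hy)).symm.trans (h.2 x hx y hy hxy)⟩

/-- Elements of either colour can be forced beyond any bound. Otherwise almost all elements of
`F r` have the same colour for suitable `r`, and a finite homogeneous set on which `G` has
computed two elements `a` and `c` still extends to a solution after the promise about `a` has been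
made to contradict the comparability of `a` and `c`. -/
theorem ContReduction.exists_forces_color (H : ContReduction F G) (p : Cond) (m : ℕ) (b : Bool) :
    ∃ q, p.Ext q ∧ q.Forces F fun Z => ∃ z ≥ m, z ∈ carrier Z ∧ Color Z b z := by
  by_contra! hno
  have mono : ∀ q, p.Ext q → ∃ r, StableOrder r ∧ q.Sat r ∧
      ∀ z ≥ m, z ∈ carrier (F r) → Color (F r) (!b) z := fun q hq =>
    H.exists_monochromatic fun q' hq' => by
      rw [Bool.not_not]
      exact hno q' (hq.trans hq')
  obtain ⟨r, hr, hpr, hcol⟩ := mono p (Cond.Ext.refl p)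
  have hZ := H.inst r hr
  obtain ⟨Y, hY, hmY, -, hYh⟩ := exists_solution hZ (infinite_of_forall_ge_color hZ hcol)
    (E := ∅) (u := m) (fun _ h => h.elim) (fun _ h => h.elim) (isHomogeneous_empty _ _)
  obtain ⟨a, c, u, E, hna, hnc, hac, hEY, hEu, hG⟩ := H.exists_pair hr hY p.n
  have hEh := hYh.mono hEY
  obtain ⟨K, hK⟩ := exists_coding_bound u
  obtain ⟨N, hN⟩ := H.cont_lt hr K
  have hB : ∀ x < max (max N p.n) (max a c + 1), ∀ y < max (max N p.n) (max a c + 1), r x y →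
      y ∈ {x | (x < p.n ∧ x ∈ p.big) ∨ (¬ (r a c ∨ r c a) ∧ r x a)} →
      x ∈ {x | (x < p.n ∧ x ∈ p.big) ∨ (¬ (r a c ∨ r c a) ∧ r x a)} := by
    rintro x - y - hxy (⟨hy, hyb⟩ | ⟨hn, hya⟩)
    · exact Or.inl (hpr.mem_big hr.trans hxy hy hyb)
    · exact Or.inr ⟨hn, hr.trans x y a hxy hya⟩
  obtain ⟨q, hqn, hqb, hqr⟩ := Cond.exists_cond hr.refl hr.antisymm hr.trans _ _ hB
  have hq : p.Ext q := by
    refine hpr.ext (by omega) hqr fun x hx => ?_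
    rw [hqb]
    refine ⟨?_, fun h => Or.inl ⟨hx, h⟩⟩
    rintro (h | h)
    · exact h.2
    · exact (hpr.2 x hx a hna).1.1 h.2
  have haq : a < q.n := by omega
  have hcq : c < q.n := by omega
  obtain ⟨r', hr', hqr', hcol'⟩ := mono q hq
  have hagree := hN r' fun x hx y hy => by
    rw [hqr'.1 x (by omega) y (by omega), hqr x (by omega) y (by omega)]
  have hEh' := hEh.congr hEu (hK _ _ hagree)
  refine H.not_all_color hr' hqr' (infinite_of_forall_ge_color (H.inst r' hr') hcol') hEu
    hEh' hG haq hcq hac ?_ fun e he => hcol' e ?_ (hEh'.1 he)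
  · rw [hqr a haq c hcq, hqr c hcq a haq, hqb]
    constructor
    · rintro (h | h)
      · omega
      · exact h.1
    · exact fun h => Or.inr ⟨h, hr.refl a⟩
  · by_contra hem
    exact (hmY e (by omega)).2 (hEY he)

/-- Below every condition there is an order for which `F` computes an instance with infinitely
many small and infinitely many isolated elements. -/
theorem ContReduction.exists_infinite_colors (H : ContReduction F G) (p : Cond) :
    ∃ r, StableOrder r ∧ p.Sat r ∧ ∀ b, {z | z ∈ carrier (F r) ∧ Color (F r) b z}.Infinite := by
  obtain ⟨r, hr, hpr, hD⟩ := p.exists_generic (fun k q => ∀ b,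
      q.Forces F fun Z => ∃ z ≥ k, z ∈ carrier Z ∧ Color Z b z) (by
    intro k q _
    obtain ⟨q₁, h₁, hf₁⟩ := H.exists_forces_color q k true
    obtain ⟨q₂, h₂, hf₂⟩ := H.exists_forces_color q₁ k false
    refine ⟨q₂, h₁.trans h₂, fun b => ?_⟩
    cases b
    · exact hf₂
    · exact fun r hr hs => hf₁ r hr (h₂.sat hs))
  refine ⟨r, hr, hpr, fun b => Set.infinite_of_forall_exists_gt fun k => ?_⟩
  obtain ⟨q, hq, hs⟩ := hD (k + 1)
  obtain ⟨z, hz, hzc⟩ := hq b r hr hs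
  exact ⟨z, hzc, hz⟩

/-! ### The two orientations -/

/-- A condition cannot promise the wrong things both about a pair computed from a finite chain
`E₁` and about a pair computed from a finite antichain `E₂` above `E₁`: some element of `E₁` would
have to be isolated, hence all elements of `E₂`, and then `E₂` extends to a solution. -/
theorem ContReduction.false_of_chain_below_antichain (H : ContReduction F G) {q : Cond}
    {E₁ E₂ : Set ℕ} {u₁ u₂ a b c d : ℕ} (hEu₁ : ∀ e ∈ E₁, e < u₁) (hEu₂ : ∀ e ∈ E₂, e < u₂)
    (hq : q.Forces F fun Z => IsHomogeneous Z true E₁ ∧ IsHomogeneous Z false E₂ ∧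
      ∀ x ∈ E₁, ∀ y ∈ E₂, rel Z x y)
    (hG₁ : ∀ Y, (∀ j < u₁, j ∈ E₁ ↔ j ∈ Y) → a ∈ G Y ∧ b ∈ G Y)
    (hG₂ : ∀ Y, (∀ j < u₂, j ∈ E₂ ↔ j ∈ Y) → c ∈ G Y ∧ d ∈ G Y)
    (ha : a < q.n) (hb : b < q.n) (hc : c < q.n) (hd : d < q.n) (hab : a ≠ b) (hcd : c ≠ d)
    (hbig₁ : a ∈ q.big ↔ ¬ (q.r a b ∨ q.r b a)) (hbig₂ : c ∈ q.big ↔ ¬ (q.r c d ∨ q.r d c)) :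
    False := by
  obtain ⟨r, hr, hs, hinf⟩ := H.exists_infinite_colors q
  obtain ⟨h₁, h₂, h₁₂⟩ := hq r hr hs
  have hZ := H.inst r hr
  refine H.not_all_color hr hs (hinf true) hEu₁ h₁ hG₁ ha hb hab hbig₁ fun e he => ?_
  by_contra hne
  refine H.not_all_color hr hs (hinf false) hEu₂ h₂ hG₂ hc hd hcd hbig₂ fun e' he' => ?_
  refine (color_or hZ (h₂.1 he') false).resolve_right ?_
  rintro ⟨k, hk⟩
  exact hne ⟨k, fun w hw hwZ =>
    iff_of_true (hZ.1.1.trans e e' w (h₁₂ e he e' he') ((hk w hw hwZ).2 rfl)) rfl⟩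

/-- No pair of functionals is a reduction for the orders with small elements and, at the same
time, for the reversed orders. -/
theorem ContReduction.not_flip (H : ContReduction F G)
    (H' : ContReduction (fun r => F (flip r)) G) : False := by
  obtain ⟨r, hr, -, hinf⟩ := H.exists_infinite_colors
    ⟨0, Eq, ∅, fun _ => rfl, fun _ _ h _ => h, fun _ _ _ => Eq.trans,
      fun _ h => absurd h (Nat.not_lt_zero _)⟩
  have hZ := H.inst r hr
  obtain ⟨Y₁, hY₁, -, hYc₁, hYh₁⟩ := exists_solution hZ (hinf true) (E := ∅) (u := 0)
    (fun _ h => h.elim) (fun _ h => h.elim) (isHomogeneous_empty _ _)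
  obtain ⟨a, b, u₁, E₁, -, -, hab, hEY₁, hEu₁, hG₁⟩ := H.exists_pair hr hY₁ 0
  obtain ⟨k, hk⟩ : ∃ k, ∀ e ∈ E₁, ∀ w ≥ k, w ∈ carrier (F r) → rel (F r) e w := by
    have hfin : E₁.Finite := (Set.finite_lt_nat u₁).subset hEu₁
    have hc : ∀ e ∈ E₁, Color (F r) true e := fun e he => hYc₁ e (hEY₁ he)
    choose! k hk using hc
    exact ⟨hfin.toFinset.sup k, fun e he w hw hwZ =>
      (hk e he w ((Finset.le_sup (hfin.mem_toFinset.2 he)).trans hw) hwZ).2 rfl⟩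
  obtain ⟨Y₂, hY₂, hkY₂, -, hYh₂⟩ := exists_solution hZ (hinf false) (E := ∅) (u := k)
    (fun _ h => h.elim) (fun _ h => h.elim) (isHomogeneous_empty _ _)
  -- Since `a` is small or isolated, it lies above no sufficiently late element.
  obtain ⟨n, hn⟩ : ∃ n, ∀ y ≥ n, ¬ r y a := by
    rcases hr.stable a with ⟨n, hn⟩ | ⟨n, hn⟩
    · refine ⟨max n (a + 1), fun y hy hya => ?_⟩
      have := hr.antisymm a y (hn y (by omega)) hya
      omega
    · exact ⟨n, fun y hy => (hn y hy).2⟩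
  obtain ⟨c, d, u₂, E₂, hc, -, hcd, hEY₂, hEu₂, hG₂⟩ := H.exists_pair hr hY₂ n
  have hca := hn c hc
  have hE₁ := hYh₁.mono hEY₁
  have hE₂ := hYh₂.mono hEY₂
  have hE₁₂ : ∀ x ∈ E₁, ∀ y ∈ E₂, rel (F r) x y := fun x hx y hy =>
    hk x hx y (not_lt.1 fun h => (hkY₂ y h).2 (hEY₂ hy)) (hE₂.1 hy)
  obtain ⟨K, hK⟩ := exists_coding_bound (max u₁ u₂)
  obtain ⟨N, hN⟩ := H.cont_lt hr K
  have hfacts : ∀ r' : ℕ → ℕ → Prop, (∀ x < N, ∀ y < N, r x y ↔ r' x y) →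
      IsHomogeneous (F r') true E₁ ∧ IsHomogeneous (F r') false E₂ ∧
        ∀ x ∈ E₁, ∀ y ∈ E₂, rel (F r') x y := by
    intro r' hrr'
    have h := hK _ _ (hN r' hrr')
    have hu₁ : ∀ e ∈ E₁, e < max u₁ u₂ := fun e he => lt_max_of_lt_left (hEu₁ e he)
    have hu₂ : ∀ e ∈ E₂, e < max u₁ u₂ := fun e he => lt_max_of_lt_right (hEu₂ e he)
    exact ⟨hE₁.congr hu₁ h, hE₂.congr hu₂ h, fun x hx y hy =>
      ((h x (hu₁ x hx)).2 y (hu₂ y hy)).1 (hE₁₂ x hx y hy)⟩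
  let M := max N (max (max a b) (max c d) + 1)
  by_cases hcomp : r c d ∨ r d c
  · -- Promise that `c` is isolated; as `c` is not below `a`, this is compatible with making `a`
    -- and everything below it small.
    have hB : ∀ x < M, ∀ y < M, r x y → y ∈ {x | ¬ (r a b ∨ r b a) ∧ r x a} →
        x ∈ {x | ¬ (r a b ∨ r b a) ∧ r x a} := fun x _ y _ hxy hy =>
      ⟨hy.1, hr.trans x y a hxy hy.2⟩
    obtain ⟨q, hqn, hqb, hqr⟩ := Cond.exists_cond hr.refl hr.antisymm hr.trans M _ hB
    refine H.false_of_chain_below_antichain (q := q) hEu₁ hEu₂ (fun r' _ hs => hfacts r' ?_)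
      hG₁ hG₂ (by omega) (by omega) (by omega) (by omega) hab hcd ?_ ?_
    · intro x hx y hy
      rw [hs.1 x (by omega) y (by omega), hqr x (by omega) y (by omega)]
    · rw [hqr a (by omega) b (by omega), hqr b (by omega) a (by omega), hqb]
      exact ⟨fun h => h.1, fun h => ⟨h, hr.refl a⟩⟩
    · rw [hqr c (by omega) d (by omega), hqr d (by omega) c (by omega), hqb]
      exact iff_of_false (fun h => hca h.2) (not_not.2 hcomp)
  · -- Promise that `c` is large, that is, small in the reversed order; then `a` is still free to
    -- be isolated or large.
    have hB : ∀ x < M, ∀ y < M, flip r x y →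
        y ∈ {x | (¬ (r a b ∨ r b a) ∧ r a x) ∨ r c x} →
        x ∈ {x | (¬ (r a b ∨ r b a) ∧ r a x) ∨ r c x} := by
      rintro x - y - hxy (hy | hy)
      · exact Or.inl ⟨hy.1, hr.trans a y x hy.2 hxy⟩
      · exact Or.inr (hr.trans c y x hy hxy)
    obtain ⟨q, hqn, hqb, hqr⟩ := Cond.exists_cond (r := flip r) hr.refl
      (fun x y h h' => hr.antisymm x y h' h) (fun x y z h h' => hr.trans z y x h' h) M _ hB
    refine H'.false_of_chain_below_antichain (q := q) hEu₁ hEu₂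
      (fun r' _ hs => hfacts (flip r') ?_)
      hG₁ hG₂ (by omega) (by omega) (by omega) (by omega) hab hcd ?_ ?_
    · intro x hx y hy
      exact ((hs.1 y (by omega) x (by omega)).trans (hqr y (by omega) x (by omega))).symm
    · rw [hqr a (by omega) b (by omega), hqr b (by omega) a (by omega), hqb]
      simp only [flip]
      rw [or_comm (a := r b a)]
      exact ⟨fun h => (h.resolve_right hca).1, fun h => Or.inl ⟨h, hr.refl a⟩⟩
    · rw [hqr c (by omega) d (by omega), hqr d (by omega) c (by omega), hqb]
      exact iff_of_true (Or.inr (hr.refl c)) fun h => hcomp h.symm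

/-! ### Coding stable orders as instances -/

/-- The code of the order `r` on all of `ℕ`. -/
def code (r : ℕ → ℕ → Prop) : Set ℕ :=
  {k | k % 2 = 0 ∨ r (k / 2).unpair.1 (k / 2).unpair.2}

theorem mem_carrier_code (r : ℕ → ℕ → Prop) (x : ℕ) : x ∈ carrier (code r) :=
  Or.inl (by omega)

theorem rel_code (r : ℕ → ℕ → Prop) : rel (code r) = r := by
  ext x y
  have h₁ : (2 * Nat.pair x y + 1) % 2 ≠ 0 := by omega
  have h₂ : (2 * Nat.pair x y + 1) / 2 = Nat.pair x y := by omega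
  change (2 * Nat.pair x y + 1) % 2 = 0 ∨ r ((2 * Nat.pair x y + 1) / 2).unpair.1
    ((2 * Nat.pair x y + 1) / 2).unpair.2 ↔ r x y
  rw [h₂, Nat.unpair_pair]
  exact or_iff_right h₁

theorem code_congr {r r' : ℕ → ℕ → Prop} {u : ℕ} (h : ∀ x < u, ∀ y < u, r x y ↔ r' x y) :
    ∀ k < u, k ∈ code r ↔ k ∈ code r' := fun k hk =>
  or_congr Iff.rfl (h _ (((Nat.unpair_left_le _).trans (Nat.div_le_self k 2)).trans_lt hk) _
    (((Nat.unpair_right_le _).trans (Nat.div_le_self k 2)).trans_lt hk))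

theorem StableOrder.isInstance_code {r : ℕ → ℕ → Prop} (hr : StableOrder r) :
    SCAC.IsInstance (code r) ∧ SCAC.IsInstance (code (flip r)) := by
  have huniv : ∀ r, carrier (code r) = Set.univ := fun r =>
    Set.eq_univ_of_forall (mem_carrier_code r)
  have hfin : ∀ (S : Set ℕ) (k : ℕ), (∀ y ≥ k, y ∉ S) → S.Finite := fun S k h =>
    (Set.finite_lt_nat k).subset fun y hy => not_le.1 fun hky => h y hky hy
  refine ⟨⟨⟨⟨?_, ?_, ?_, ?_⟩, ?_⟩, Or.inl fun x _ => ?_⟩,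
    ⟨⟨?_, ?_, ?_, ?_⟩, ?_⟩, Or.inr fun x _ => ?_⟩
  · exact fun x y _ => ⟨mem_carrier_code r x, mem_carrier_code r y⟩
  · rw [rel_code]
    exact fun x _ => hr.refl x
  · rw [rel_code]
    exact hr.antisymm
  · rw [rel_code]
    exact hr.trans
  · rw [huniv]
    exact Set.infinite_univ
  · rw [IsSmall, IsIsolated, rel_code]
    rcases hr.stable x with ⟨k, hk⟩ | ⟨k, hk⟩
    · exact Or.inl (hfin _ k fun y hy h => h.2 (hk y hy))
    · exact Or.inr (hfin _ k fun y hy h => h.2.elim (hk y hy).1 (hk y hy).2)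
  · exact fun x y _ => ⟨mem_carrier_code _ x, mem_carrier_code _ y⟩
  · rw [rel_code]
    exact fun x _ => hr.refl x
  · rw [rel_code]
    exact fun x y h h' => hr.antisymm x y h' h
  · rw [rel_code]
    exact fun x y z h h' => hr.trans z y x h' h
  · rw [huniv]
    exact Set.infinite_univ
  · rw [IsLarge, IsIsolated, rel_code]
    rcases hr.stable x with ⟨k, hk⟩ | ⟨k, hk⟩
    · exact Or.inl (hfin _ k fun y hy h => h.2 (hk y hy))
    · exact Or.inr (hfin _ k fun y hy h => h.2.elim (hk y hy).2 (hk y hy).1)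

/-- A strong Weihrauch reduction restricts to a continuous reduction along every local coding `C`
of stable orders by instances. -/
theorem contReduction_of_reducible {Φ Ψ : OracleCode}
    (h : ∀ X, SCAC.IsInstance X → ∃ Z, Φ.Defines X Z ∧ omegaSCAC.IsInstance Z ∧
      ∀ Y, omegaSCAC.IsSolution Z Y → ∃ W, Ψ.Defines Y W ∧ SCAC.IsSolution X W)
    (C : (ℕ → ℕ → Prop) → Set ℕ) (hC : ∀ r, StableOrder r → SCAC.IsInstance (C r))
    (hsol : ∀ r W, SCAC.IsSolution (C r) W → IsChain r W ∨ IsAntichain r W)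
    (hloc : ∀ r r' : ℕ → ℕ → Prop, ∀ u, (∀ x < u, ∀ y < u, r x y ↔ r' x y) →
      ∀ k < u, k ∈ C r ↔ k ∈ C r') :
    ContReduction (fun r => Φ.output (C r)) Ψ.output where
  inst r hr := by
    obtain ⟨Z, hZ, hI, -⟩ := h _ (hC r hr)
    rw [hZ.output_eq]
    exact hI
  sol r hr Y hY := by
    obtain ⟨Z, hZ, -, hS⟩ := h _ (hC r hr)
    rw [hZ.output_eq] at hY
    obtain ⟨W, hW, hWS⟩ := hS Y hY
    rw [hW.output_eq]
    exact ⟨hWS.2.1, hsol r W hWS⟩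
  cont r hr k := by
    obtain ⟨Z, hZ, -⟩ := h _ (hC r hr)
    obtain ⟨u, hu⟩ := hZ.output_continuous k
    exact ⟨u, fun r' hr' => hu _ (hloc r r' u hr')⟩
  cont_back Y k hk := OracleCode.output_continuous hk

end CompRed

theorem mainTheorem3 :
    ¬ CompRed.StrongWeihrauchReducible CompRed.SCAC CompRed.omegaSCAC := by
  rintro ⟨Φ, Ψ, h⟩
  refine CompRed.ContReduction.not_flip
    (F := fun r => Φ.output (CompRed.code r)) (G := Ψ.output)
    (CompRed.contReduction_of_reducible h CompRed.code (fun r hr => hr.isInstance_code.1) ?_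
      fun r r' u => CompRed.code_congr)
    (CompRed.contReduction_of_reducible h (fun r => CompRed.code (flip r))
      (fun r hr => hr.isInstance_code.2) ?_
      fun r r' u hrr' => CompRed.code_congr fun x hx y hy => hrr' y hy x hx)
  · intro r W hW
    have := hW.2.2
    rwa [CompRed.rel_code] at this
  · intro r W hW
    have := hW.2.2
    rw [CompRed.rel_code] at this
    exact this.imp (fun h => h.symm) fun h => h.flip
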